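/- Let $R$ be a 3-polygraph: a directed graph (its 0- and 1-generators), a set of 2-generators, each with a source and a target which are parallel paths of the graph, and a set of 3-generators $r:\alpha\Rrightarrow\beta$ (rewriting rules), each with a source $\alpha$ and a target $\beta$ which are parallel 2-cells of the free 2-category $\mathcal C$ on the underlying 2-polygraph $S$ (given by the 0-, 1- and 2-generators). *Contexts.* For pairs of parallel 1-cells $(f_1,g_1),\dots,(f_n,g_n),(f,g)$ of $\mathcal C$, a context $K:((f_1,g_1),\dots,(f_n,g_n))\to(f,g)$ is a 2-cell $f\Rightarrow g$ of the free 2-category on $S[X_1:f_1\Rightarrow g_1,\dots,X_n:f_n\Rightarrow g_n]$ (the 2-polygraph $S$ with fresh 2-generators $X_i$ added) in which every $X_i$ occurs exactly once. Contexts compose by substitution and form a multicategory, whose identities are $\mathrm{Id}_{(f,g)}=X_1$; the 2-cells $\alpha:f\Rightarrow g$ of $\mathcal C$ are its nullary morphisms $()\to(f,g)$. *Unifiers.* A unifier of 2-cells $\alpha_1:f_1\Rightarrow g_1$ and $\alpha_2:f_2\Rightarrow g_2$ of $\mathcal C$ is a pair of unary contexts $K_1:((f_1,g_1))\to(f,g)$,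 $K_2:((f_2,g_2))\to(f,g)$ with $K_1\circ(\alpha_1)=K_2\circ(\alpha_2)$. It is a most general unifier if it is - non-trivial: there is no binary context $K:((f_1,g_1),(f_2,g_2))\to(f,g)$ with $K_1=K\circ(\mathrm{Id}_{(f_1,g_1)},\alpha_2)$ and $K_2=K\circ(\alpha_1,\mathrm{Id}_{(f_2,g_2)})$; and - minimal: whenever $K_1',K_2'$ is a unifier of $\alpha_1,\alpha_2$ and $K''$ is a unary context with $K_1=K''\circ K_1'$ and $K_2=K''\circ K_2'$, the context $K''$ is invertible. *Peaks and critical pairs.* A peak consists of 2-cells $\alpha,\alpha_1,\alpha_2$ of $\mathcal C$, 3-generators $r_1:\lambda_1\Rrightarrow\rho_1$ and $r_2:\lambda_2\Rrightarrow\rho_2$, and unary contexts $K_1,K_2$ with $\alpha=K_i\circ(\lambda_i)$ and $\alpha_i=K_i\circ(\rho_i)$ for $i=1,2$. It is joinable if there are a 2-cell $\beta$ and 3-cells $\alpha_1\Rrightarrow\beta$ and $\alpha_2\Rrightarrow\beta$ in the free 3-category on $R$. A critical pair $(K_1,r_1,K_2,r_2)$ consists of two (possibly equal) 3-generators $r_1,r_2$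 as above and a most general unifier $K_1,K_2$ of their sources $\lambda_1,\lambda_2$; it is joinable if the peak formed by $\alpha=K_1\circ(\lambda_1)=K_2\circ(\lambda_2)$, $\alpha_1=K_1\circ(\rho_1)$ and $\alpha_2=K_2\circ(\rho_2)$ is joinable. **Proposition.** If all critical pairs of $R$ are joinable, then $R$ is locally confluent, i.e. every peak of $R$ is joinable. -/

import Mathlib

universe w' w v u

namespace Polygraph

open Quiver (Path)

/-! ## Signatures (2-polygraphs) and the 2-cells they generate

The 0-generators and 1-generators form a directed graph `V` (a `Quiver`); the free category on it
has the paths `Path a b` as its 1-cells, with concatenation `f.comp g` as composition `f ⊗ g`. -/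

/-- A pair of parallel 1-cells `src, tgt : s → t` of the free category on the graph `V`. -/
structure Sphere (V : Type u) [Quiver.{v} V] where
  {s t : V}
  (src tgt : Path s t)

/-- A 2-polygraph on the graph `V`: a set of 2-generators, each one with a source and a target
which are parallel paths. -/
structure Signature (V : Type u) [Quiver.{v} V] where
  Gen : Type w
  bd : Gen → Sphere V

variable {V : Type u} [Quiver.{v} V]

/-- Formal vertical and horizontal composites of 2-generators. Vertical composition is written in
diagrammatic order: `vcomp e d` is "`d ∘ e`". -/
inductive Expr₂ (S : Signature.{w} V) : ∀ {a b : V}, Path a b → Path a b → Type (max u v w)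
  | id {a b : V} (f : Path a b) : Expr₂ S f f
  | gen (x : S.Gen) : Expr₂ S (S.bd x).src (S.bd x).tgt
  | vcomp {a b : V} {f g h : Path a b} : Expr₂ S f g → Expr₂ S g h → Expr₂ S f h
  | hcomp {a b c : V} {f g : Path a b} {h k : Path b c} :
      Expr₂ S f g → Expr₂ S h k → Expr₂ S (f.comp h) (g.comp k)

/-- The congruence on formal composites generated by the axioms of (strict) 2-categories. The two
sides may have boundaries that are only propositionally equal (e.g. `(f ⊗ g) ⊗ h` and
`f ⊗ (g ⊗ h)`). -/
inductive Rel₂ (S : Signature.{w} V) :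
    ∀ {a b : V} {f g f' g' : Path a b}, Expr₂ S f g → Expr₂ S f' g' → Prop
  | refl {a b : V} {f g : Path a b} (e : Expr₂ S f g) : Rel₂ S e e
  | symm {a b : V} {f g f' g' : Path a b} {e : Expr₂ S f g} {e' : Expr₂ S f' g'} :
      Rel₂ S e e' → Rel₂ S e' e
  | trans {a b : V} {f g f' g' f'' g'' : Path a b} {e : Expr₂ S f g} {e' : Expr₂ S f' g'}
      {e'' : Expr₂ S f'' g''} : Rel₂ S e e' → Rel₂ S e' e'' → Rel₂ S e e''
  | vcomp_congr {a b : V} {f g h f' g' h' : Path a b} {e : Expr₂ S f g} {d : Expr₂ S g h}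
      {e' : Expr₂ S f' g'} {d' : Expr₂ S g' h'} :
      Rel₂ S e e' → Rel₂ S d d' → Rel₂ S (e.vcomp d) (e'.vcomp d')
  | hcomp_congr {a b c : V} {f g f' g' : Path a b} {h k h' k' : Path b c}
      {e : Expr₂ S f g} {d : Expr₂ S h k} {e' : Expr₂ S f' g'} {d' : Expr₂ S h' k'} :
      Rel₂ S e e' → Rel₂ S d d' → Rel₂ S (e.hcomp d) (e'.hcomp d')
  | vcomp_assoc {a b : V} {f g h k : Path a b} (e₁ : Expr₂ S f g) (e₂ : Expr₂ S g h)
      (e₃ : Expr₂ S h k) : Rel₂ S ((e₁.vcomp e₂).vcomp e₃) (e₁.vcomp (e₂.vcomp e₃))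
  | id_vcomp {a b : V} {f g : Path a b} (e : Expr₂ S f g) : Rel₂ S ((Expr₂.id f).vcomp e) e
  | vcomp_id {a b : V} {f g : Path a b} (e : Expr₂ S f g) : Rel₂ S (e.vcomp (Expr₂.id g)) e
  | hcomp_assoc {a b c d : V} {f₁ g₁ : Path a b} {f₂ g₂ : Path b c} {f₃ g₃ : Path c d}
      (e₁ : Expr₂ S f₁ g₁) (e₂ : Expr₂ S f₂ g₂) (e₃ : Expr₂ S f₃ g₃) :
      Rel₂ S ((e₁.hcomp e₂).hcomp e₃) (e₁.hcomp (e₂.hcomp e₃))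
  | id_hcomp {a b : V} {f g : Path a b} (e : Expr₂ S f g) :
      Rel₂ S ((Expr₂.id (Path.nil : Path a a)).hcomp e) e
  | hcomp_id {a b : V} {f g : Path a b} (e : Expr₂ S f g) :
      Rel₂ S (e.hcomp (Expr₂.id (Path.nil : Path b b))) e
  | exchange {a b c : V} {f g h : Path a b} {f' g' h' : Path b c} (e₁ : Expr₂ S f g)
      (e₂ : Expr₂ S g h) (d₁ : Expr₂ S f' g') (d₂ : Expr₂ S g' h') :
      Rel₂ S ((e₁.vcomp e₂).hcomp (d₁.vcomp d₂)) ((e₁.hcomp d₁).vcomp (e₂.hcomp d₂))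
  | exchange_id {a b c : V} (f : Path a b) (g : Path b c) :
      Rel₂ S ((Expr₂.id f).hcomp (Expr₂.id g)) (Expr₂.id (f.comp g))

def cellSetoid (S : Signature.{w} V) {a b : V} (f g : Path a b) : Setoid (Expr₂ S f g) where
  r e e' := Rel₂ S e e'
  iseqv := ⟨Rel₂.refl, Rel₂.symm, Rel₂.trans⟩

/-- The 2-cells `f ⇒ g` of the free 2-category on the 2-polygraph `S`. -/
def Cell₂ (S : Signature.{w} V) {a b : V} (f g : Path a b) : Type (max u v w) :=
  Quotient (cellSetoid S f g)

namespace Cell₂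

variable {S : Signature.{w} V}

def mk {a b : V} {f g : Path a b} (e : Expr₂ S f g) : Cell₂ S f g :=
  Quotient.mk (cellSetoid S f g) e

def id {a b : V} (f : Path a b) : Cell₂ S f f := mk (Expr₂.id f)

def gen (x : S.Gen) : Cell₂ S (S.bd x).src (S.bd x).tgt := mk (Expr₂.gen x)

def vcomp {a b : V} {f g h : Path a b} (α : Cell₂ S f g) (β : Cell₂ S g h) : Cell₂ S f h :=
  Quotient.liftOn₂ α β (fun e d => mk (e.vcomp d))
    (fun _ _ _ _ h₁ h₂ => Quotient.sound (Rel₂.vcomp_congr h₁ h₂))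

def hcomp {a b c : V} {f g : Path a b} {h k : Path b c} (α : Cell₂ S f g) (β : Cell₂ S h k) :
    Cell₂ S (f.comp h) (g.comp k) :=
  Quotient.liftOn₂ α β (fun e d => mk (e.hcomp d))
    (fun _ _ _ _ h₁ h₂ => Quotient.sound (Rel₂.hcomp_congr h₁ h₂))

end Cell₂

/-! ## Counting occurrences of generators -/

/-- The sum of `p x` over all the occurrences of 2-generators `x` in a formal composite. -/
def Expr₂.weight {S : Signature.{w} V} (p : S.Gen → ℕ) :
    ∀ {a b : V} {f g : Path a b}, Expr₂ S f g → ℕ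
  | _, _, _, _, .id _ => 0
  | _, _, _, _, .gen x => p x
  | _, _, _, _, .vcomp e d => e.weight p + d.weight p
  | _, _, _, _, .hcomp e d => e.weight p + d.weight p

theorem Rel₂.weight_eq {S : Signature.{w} V} (p : S.Gen → ℕ) {a b : V} {f g f' g' : Path a b}
    {e : Expr₂ S f g} {e' : Expr₂ S f' g'} (h : Rel₂ S e e') : e.weight p = e'.weight p := by
  induction h with
  | refl => rfl
  | symm _ ih => exact ih.symm
  | trans _ _ ih₁ ih₂ => exact ih₁.trans ih₂
  | vcomp_congr _ _ ih₁ ih₂ => simp only [Expr₂.weight, ih₁, ih₂]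
  | hcomp_congr _ _ ih₁ ih₂ => simp only [Expr₂.weight, ih₁, ih₂]
  | _ => simp only [Expr₂.weight]; try omega

def Cell₂.weight {S : Signature.{w} V} (p : S.Gen → ℕ) {a b : V} {f g : Path a b}
    (α : Cell₂ S f g) : ℕ :=
  Quotient.liftOn α (fun e => e.weight p) (fun _ _ h => Rel₂.weight_eq p h)

open Classical in
/-- The number of occurrences of the 2-generator `x` in the 2-cell `α`. -/
noncomputable def Cell₂.occ {S : Signature.{w} V} {a b : V} {f g : Path a b}
    (α : Cell₂ S f g) (x : S.Gen) : ℕ :=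
  α.weight (fun y => if y = x then 1 else 0)

/-! ## Substitution -/

/-- Replace every 2-generator `x` of a formal composite by the formal composite `σ x`. -/
def Expr₂.bind {S T : Signature.{w} V} (σ : ∀ x : S.Gen, Expr₂ T (S.bd x).src (S.bd x).tgt) :
    ∀ {a b : V} {f g : Path a b}, Expr₂ S f g → Expr₂ T f g
  | _, _, _, _, .id f => .id f
  | _, _, _, _, .gen x => σ x
  | _, _, _, _, .vcomp e d => .vcomp (e.bind σ) (d.bind σ)
  | _, _, _, _, .hcomp e d => .hcomp (e.bind σ) (d.bind σ)

theorem Rel₂.bind {S T : Signature.{w} V}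
    (σ : ∀ x : S.Gen, Expr₂ T (S.bd x).src (S.bd x).tgt) {a b : V} {f g f' g' : Path a b}
    {e : Expr₂ S f g} {e' : Expr₂ S f' g'} (h : Rel₂ S e e') :
    Rel₂ T (e.bind σ) (e'.bind σ) := by
  induction h with
  | refl => exact .refl _
  | symm _ ih => exact .symm ih
  | trans _ _ ih₁ ih₂ => exact .trans ih₁ ih₂
  | vcomp_congr _ _ ih₁ ih₂ => exact .vcomp_congr ih₁ ih₂
  | hcomp_congr _ _ ih₁ ih₂ => exact .hcomp_congr ih₁ ih₂
  | vcomp_assoc => exact .vcomp_assoc _ _ _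
  | id_vcomp => exact .id_vcomp _
  | vcomp_id => exact .vcomp_id _
  | hcomp_assoc => exact .hcomp_assoc _ _ _
  | id_hcomp => exact .id_hcomp _
  | hcomp_id => exact .hcomp_id _
  | exchange => exact .exchange _ _ _ _
  | exchange_id => exact .exchange_id _ _

/-- Replace every 2-generator `x` of a 2-cell by the 2-cell `σ x`. -/
noncomputable def Cell₂.bind {S T : Signature.{w} V}
    (σ : ∀ x : S.Gen, Cell₂ T (S.bd x).src (S.bd x).tgt) {a b : V} {f g : Path a b}
    (α : Cell₂ S f g) : Cell₂ T f g :=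
  Quotient.liftOn α (fun e => Cell₂.mk (e.bind fun x => Quotient.out (σ x)))
    (fun _ _ h => Quotient.sound (Rel₂.bind _ h))

section Functoriality

variable {S T : Signature.{w} V} (σ : ∀ x : S.Gen, Cell₂ T (S.bd x).src (S.bd x).tgt)

/-- `Cell₂.bind σ` is the 2-functor determined by `σ`. -/
@[simp] theorem Cell₂.bind_id {a b : V} (f : Path a b) :
    (Cell₂.id f : Cell₂ S f f).bind σ = Cell₂.id f := rfl

@[simp] theorem Cell₂.bind_gen (x : S.Gen) : (Cell₂.gen x).bind σ = σ x :=
  Quotient.out_eq (σ x)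

@[simp] theorem Cell₂.bind_vcomp {a b : V} {f g h : Path a b} (α : Cell₂ S f g)
    (β : Cell₂ S g h) : (α.vcomp β).bind σ = (α.bind σ).vcomp (β.bind σ) := by
  induction α using Quotient.inductionOn
  induction β using Quotient.inductionOn
  rfl

@[simp] theorem Cell₂.bind_hcomp {a b c : V} {f g : Path a b} {h k : Path b c} (α : Cell₂ S f g)
    (β : Cell₂ S h k) : (α.hcomp β).bind σ = (α.bind σ).hcomp (β.bind σ) := by
  induction α using Quotient.inductionOn
  induction β using Quotient.inductionOn
  rfl

@[simp] theorem Cell₂.weight_gen (p : S.Gen → ℕ) (x : S.Gen) : (Cell₂.gen x).weight p = p x := rfl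

theorem Cell₂.weight_bind (p : T.Gen → ℕ) {a b : V} {f g : Path a b} (α : Cell₂ S f g) :
    (α.bind σ).weight p = α.weight (fun x => (σ x).weight p) := by
  induction α using Quotient.inductionOn with
  | h e =>
    change (e.bind fun x => Quotient.out (σ x)).weight p = e.weight _
    induction e with
    | id => rfl
    | gen x =>
      change (Quotient.out (σ x)).weight p = (σ x).weight p
      conv_rhs => rw [← Quotient.out_eq (σ x)]
      rfl
    | vcomp _ _ ih₁ ih₂ => simp only [Expr₂.bind, Expr₂.weight, ih₁, ih₂]
    | hcomp _ _ ih₁ ih₂ => simp only [Expr₂.bind, Expr₂.weight, ih₁, ih₂]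

theorem Cell₂.weight_add (p q : S.Gen → ℕ) {a b : V} {f g : Path a b} (α : Cell₂ S f g) :
    α.weight (p + q) = α.weight p + α.weight q := by
  induction α using Quotient.inductionOn with
  | h e =>
    change e.weight _ = e.weight _ + e.weight _
    induction e with
    | id => rfl
    | gen x => rfl
    | vcomp _ _ ih₁ ih₂ => simp only [Expr₂.weight, ih₁, ih₂]; omega
    | hcomp _ _ ih₁ ih₂ => simp only [Expr₂.weight, ih₁, ih₂]; omega

theorem Cell₂.weight_mul (c : ℕ) (p : S.Gen → ℕ) {a b : V} {f g : Path a b} (α : Cell₂ S f g) :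
    α.weight (fun x => c * p x) = c * α.weight p := by
  induction α using Quotient.inductionOn with
  | h e =>
    change e.weight _ = c * e.weight _
    induction e with
    | id => rfl
    | gen x => rfl
    | vcomp _ _ ih₁ ih₂ => simp only [Expr₂.weight, ih₁, ih₂]; ring
    | hcomp _ _ ih₁ ih₂ => simp only [Expr₂.weight, ih₁, ih₂]; ring

theorem Cell₂.weight_zero {a b : V} {f g : Path a b} (α : Cell₂ S f g) :
    α.weight (fun _ => 0) = 0 := by
  simpa using α.weight_mul 0 (fun _ => 0)

end Functoriality

/-! ## Contexts -/

/-- The 2-generators of `S`, together with `n` fresh variables. -/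
inductive ExtGen (S : Signature.{w} V) (n : ℕ) : Type w
  | old (x : S.Gen) : ExtGen S n
  | new (i : Fin n) : ExtGen S n

/-- The signature `S[X₀ : Γ 0, …, Xₙ₋₁ : Γ (n-1)]`, obtained from `S` by adding the variables `Xᵢ`
as 2-generators, with the boundary `Γ i`. -/
abbrev Signature.ext (S : Signature.{w} V) {n : ℕ} (Γ : Fin n → Sphere V) : Signature.{w} V where
  Gen := ExtGen S n
  bd := fun
    | .old x => S.bd x
    | .new i => Γ i

/-- The assignment sending the 2-generators `x` of `S` to `σ x` and the variables `Xᵢ` to `L i`. -/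
def extAssign {S T : Signature.{w} V} {n : ℕ} {Γ : Fin n → Sphere V}
    (σ : ∀ x : S.Gen, Cell₂ T (S.bd x).src (S.bd x).tgt)
    (L : ∀ i, Cell₂ T (Γ i).src (Γ i).tgt) :
    ∀ y : (S.ext Γ).Gen, Cell₂ T ((S.ext Γ).bd y).src ((S.ext Γ).bd y).tgt
  | .old x => σ x
  | .new i => L i

/-- A 2-generator of `S`, as a 2-cell over `S[Γ]`. -/
def Cell₂.oldGen {S : Signature.{w} V} {n : ℕ} (Γ : Fin n → Sphere V) (x : S.Gen) :
    Cell₂ (S.ext Γ) (S.bd x).src (S.bd x).tgt :=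
  Cell₂.gen (S := S.ext Γ) (.old x)

/-- The variable `Xᵢ`, as a 2-cell over `S[Γ]`. -/
def Cell₂.var (S : Signature.{w} V) {n : ℕ} (Γ : Fin n → Sphere V) (i : Fin n) :
    Cell₂ (S.ext Γ) (Γ i).src (Γ i).tgt :=
  Cell₂.gen (S := S.ext Γ) (.new i)

/-- The inclusion of the 2-cells over `S` into those over `S[Γ]`. -/
noncomputable def Cell₂.incl {S : Signature.{w} V} {n : ℕ} (Γ : Fin n → Sphere V) {a b : V}
    {f g : Path a b} (α : Cell₂ S f g) : Cell₂ (S.ext Γ) f g :=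
  α.bind (Cell₂.oldGen Γ)

/-- Substitute the 2-cells `L i` over `S[Δ]` for the variables `Xᵢ` in a 2-cell over `S[Γ]`. -/
noncomputable def Cell₂.subst {S : Signature.{w} V} {n m : ℕ} {Γ : Fin n → Sphere V}
    {Δ : Fin m → Sphere V} {a b : V} {f g : Path a b} (α : Cell₂ (S.ext Γ) f g)
    (L : ∀ i, Cell₂ (S.ext Δ) (Γ i).src (Γ i).tgt) : Cell₂ (S.ext Δ) f g :=
  α.bind (extAssign (Cell₂.oldGen Δ) L)

/-- A family indexed by `Fin 1`, given by its only member. -/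
def single {T : Signature.{w} V} {A : Sphere V} (α : Cell₂ T A.src A.tgt) :
    ∀ i, Cell₂ T (![A] i).src (![A] i).tgt
  | 0 => α

/-- A family indexed by `Fin 2`, given by its two members. -/
def pair {T : Signature.{w} V} {A₁ A₂ : Sphere V} (α₁ : Cell₂ T A₁.src A₁.tgt)
    (α₂ : Cell₂ T A₂.src A₂.tgt) : ∀ i, Cell₂ T (![A₁, A₂] i).src (![A₁, A₂] i).tgt
  | 0 => α₁
  | 1 => α₂

/-- A context `K : (Γ 0, …, Γ (n-1)) → B`: a 2-cell over `S[Γ]` in which every variable occurs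
exactly once. -/
@[ext] structure Context (S : Signature.{w} V) {n : ℕ} (Γ : Fin n → Sphere V) (B : Sphere V) where
  cell : Cell₂ (S.ext Γ) B.src B.tgt
  linear : ∀ i, cell.occ (.new i) = 1

theorem Cell₂.occ_var (S : Signature.{w} V) {n : ℕ} (Γ : Fin n → Sphere V) (i j : Fin n) :
    (Cell₂.var S Γ i).occ (.new j) = if i = j then 1 else 0 := by
  classical
  simp [Cell₂.occ, Cell₂.var]

theorem Cell₂.occ_oldGen {S : Signature.{w} V} {n : ℕ} (Γ : Fin n → Sphere V) (x : S.Gen)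
    (j : Fin n) : (Cell₂.oldGen Γ x).occ (.new j) = 0 := by
  classical
  simp [Cell₂.occ, Cell₂.oldGen]

theorem Cell₂.occ_bind {S T : Signature.{w} V}
    (σ : ∀ x : S.Gen, Cell₂ T (S.bd x).src (S.bd x).tgt) (y : T.Gen) {a b : V} {f g : Path a b}
    (α : Cell₂ S f g) : (α.bind σ).occ y = α.weight (fun x => (σ x).occ y) := by
  classical
  exact Cell₂.weight_bind σ _ α

theorem Cell₂.occ_incl {S : Signature.{w} V} {n : ℕ} (Γ : Fin n → Sphere V) {a b : V}
    {f g : Path a b} (α : Cell₂ S f g) (j : Fin n) : (α.incl Γ).occ (.new j) = 0 := by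
  unfold Cell₂.incl
  simp only [Cell₂.occ_bind, Cell₂.occ_oldGen]
  exact α.weight_zero

/-- The weight of a 2-cell over `S[Γ]` in which only the variables count. -/
theorem Cell₂.weight_new {S : Signature.{w} V} {n : ℕ} {Γ : Fin n → Sphere V} {a b : V}
    {f g : Path a b} (α : Cell₂ (S.ext Γ) f g) (p : ExtGen S n → ℕ) (hp : ∀ x, p (.old x) = 0) :
    α.weight p = ∑ i, p (.new i) * α.occ (.new i) := by
  classical
  have key : ∀ s : Finset (Fin n),
      α.weight (fun x : ExtGen S n => ∑ i ∈ s, p (.new i) * if x = .new i then 1 else 0)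
        = ∑ i ∈ s, p (.new i) * α.occ (.new i) := by
    intro s
    induction s using Finset.induction_on with
    | empty => simpa using α.weight_zero
    | insert i s hi ih =>
      simp only [Finset.sum_insert hi]
      rw [← ih]
      unfold Cell₂.occ
      rw [← Cell₂.weight_mul, ← Cell₂.weight_add]
      congr 1
  rw [← key Finset.univ]
  congr 1
  funext x
  cases x with
  | old x => simp [hp]
  | new i => simp

theorem Cell₂.occ_subst {S : Signature.{w} V} {n m : ℕ} {Γ : Fin n → Sphere V}
    {Δ : Fin m → Sphere V} {a b : V} {f g : Path a b} (α : Cell₂ (S.ext Γ) f g)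
    (L : ∀ i, Cell₂ (S.ext Δ) (Γ i).src (Γ i).tgt) (j : Fin m) :
    (α.subst L).occ (.new j) = ∑ i, (L i).occ (.new j) * α.occ (.new i) := by
  unfold Cell₂.subst
  rw [Cell₂.occ_bind, Cell₂.weight_new]
  · rfl
  · exact fun x => Cell₂.occ_oldGen Δ x j

namespace Context

variable {S : Signature.{w} V}

/-- The identity context `Id_A : (A) → A`. -/
def id (S : Signature.{w} V) (A : Sphere V) : Context S ![A] A where
  cell := Cell₂.var S ![A] 0
  linear i := by
    obtain rfl := Subsingleton.elim i 0
    exact (Cell₂.occ_var S ![A] 0 0).trans (if_pos rfl)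

/-- The composite `K ∘ (α)` of a unary context with a nullary one, i.e. with a 2-cell. -/
noncomputable def app {A B : Sphere V} (K : Context S ![A] B) (α : Cell₂ S A.src A.tgt) :
    Cell₂ S B.src B.tgt :=
  K.cell.bind (extAssign Cell₂.gen (single α))

/-- The composite `K ∘ L` of unary contexts. -/
noncomputable def comp {A B C : Sphere V} (K : Context S ![B] C) (L : Context S ![A] B) :
    Context S ![A] C where
  cell := K.cell.subst (single L.cell)
  linear j := by
    rw [Cell₂.occ_subst, Fin.sum_univ_one, K.linear, mul_one]
    exact L.linear j

/-- The composite `K ∘ (Id, α₂)` of a binary context. -/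
noncomputable def fillRight {A₁ A₂ B : Sphere V} (K : Context S ![A₁, A₂] B)
    (α₂ : Cell₂ S A₂.src A₂.tgt) : Context S ![A₁] B where
  cell := K.cell.subst (pair (id S A₁).cell (α₂.incl ![A₁]))
  linear j := by
    rw [Cell₂.occ_subst, Fin.sum_univ_two, K.linear, K.linear, mul_one, mul_one]
    exact congrArg₂ (· + ·) ((id S A₁).linear j) (Cell₂.occ_incl ![A₁] α₂ j)

/-- The composite `K ∘ (α₁, Id)` of a binary context. -/
noncomputable def fillLeft {A₁ A₂ B : Sphere V} (K : Context S ![A₁, A₂] B)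
    (α₁ : Cell₂ S A₁.src A₁.tgt) : Context S ![A₂] B where
  cell := K.cell.subst (pair (α₁.incl ![A₂]) (id S A₂).cell)
  linear j := by
    rw [Cell₂.occ_subst, Fin.sum_univ_two, K.linear, K.linear, mul_one, mul_one]
    exact congrArg₂ (· + ·) (Cell₂.occ_incl ![A₂] α₁ j) ((id S A₂).linear j)

/-- Invertibility of a unary context. -/
def Invertible {A B : Sphere V} (K : Context S ![A] B) : Prop :=
  ∃ L : Context S ![B] A, K.comp L = id S B ∧ L.comp K = id S A

end Context

/-! ## Unifiers -/

section Unifiers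

variable {S : Signature.{w} V} {A₁ A₂ : Sphere V}

/-- `K₁, K₂` is a unifier of `α₁` and `α₂`. -/
def IsUnifier (α₁ : Cell₂ S A₁.src A₁.tgt) (α₂ : Cell₂ S A₂.src A₂.tgt) {B : Sphere V}
    (K₁ : Context S ![A₁] B) (K₂ : Context S ![A₂] B) : Prop :=
  K₁.app α₁ = K₂.app α₂

/-- `α₁` and `α₂` occur in disjoint positions. -/
def IsTrivial (α₁ : Cell₂ S A₁.src A₁.tgt) (α₂ : Cell₂ S A₂.src A₂.tgt) {B : Sphere V}
    (K₁ : Context S ![A₁] B) (K₂ : Context S ![A₂] B) : Prop :=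
  ∃ K : Context S ![A₁, A₂] B, K₁ = K.fillRight α₂ ∧ K₂ = K.fillLeft α₁

/-- Every unifier through which `K₁, K₂` factors, by one common context, does so by an invertible
context. -/
def IsMinimal (α₁ : Cell₂ S A₁.src A₁.tgt) (α₂ : Cell₂ S A₂.src A₂.tgt) {B : Sphere V}
    (K₁ : Context S ![A₁] B) (K₂ : Context S ![A₂] B) : Prop :=
  ∀ (B' : Sphere V) (K₁' : Context S ![A₁] B') (K₂' : Context S ![A₂] B')
    (K'' : Context S ![B'] B), IsUnifier α₁ α₂ K₁' K₂' →
      K₁ = K''.comp K₁' → K₂ = K''.comp K₂' → K''.Invertible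

/-- Most general unifiers. -/
structure IsMostGeneralUnifier (α₁ : Cell₂ S A₁.src A₁.tgt) (α₂ : Cell₂ S A₂.src A₂.tgt)
    {B : Sphere V} (K₁ : Context S ![A₁] B) (K₂ : Context S ![A₂] B) : Prop where
  unifier : IsUnifier α₁ α₂ K₁ K₂
  nontrivial : ¬ IsTrivial α₁ α₂ K₁ K₂
  minimal : IsMinimal α₁ α₂ K₁ K₂

end Unifiers

/-! ## 3-polygraphs and the 3-cells they generate -/

set_option linter.checkUnivs false in
/-- A 3-polygraph on the graph `V`: a 2-polygraph, together with a set of 3-generators (rewriting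
rules), each one with a source and a target which are parallel 2-cells. -/
structure ThreePolygraph (V : Type u) [Quiver.{v} V] where
  sig : Signature.{w} V
  Rule : Type w'
  bd : Rule → Sphere V
  lhs : ∀ r : Rule, Cell₂ sig (bd r).src (bd r).tgt
  rhs : ∀ r : Rule, Cell₂ sig (bd r).src (bd r).tgt

/-- Formal composites of 3-generators: `comp`, `vcomp` and `hcomp` are the compositions along
2-cells, 1-cells and 0-cells. -/
inductive Expr₃ (R : ThreePolygraph.{w', w} V) :
    ∀ {a b : V} {f g : Path a b}, Cell₂ R.sig f g → Cell₂ R.sig f g → Type (max u v w w')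
  | id {a b : V} {f g : Path a b} (α : Cell₂ R.sig f g) : Expr₃ R α α
  | gen (r : R.Rule) : Expr₃ R (R.lhs r) (R.rhs r)
  | comp {a b : V} {f g : Path a b} {α β γ : Cell₂ R.sig f g} :
      Expr₃ R α β → Expr₃ R β γ → Expr₃ R α γ
  | vcomp {a b : V} {f g h : Path a b} {α α' : Cell₂ R.sig f g} {β β' : Cell₂ R.sig g h} :
      Expr₃ R α α' → Expr₃ R β β' → Expr₃ R (α.vcomp β) (α'.vcomp β')
  | hcomp {a b c : V} {f g : Path a b} {h k : Path b c} {α α' : Cell₂ R.sig f g}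
      {β β' : Cell₂ R.sig h k} :
      Expr₃ R α α' → Expr₃ R β β' → Expr₃ R (α.hcomp β) (α'.hcomp β')

/-- The congruence on formal composites generated by the axioms of (strict) 3-categories. -/
inductive Rel₃ (R : ThreePolygraph.{w', w} V) :
    ∀ {a b : V} {f g f' g' : Path a b} {α β : Cell₂ R.sig f g} {α' β' : Cell₂ R.sig f' g'},
      Expr₃ R α β → Expr₃ R α' β' → Prop
  | refl {a b : V} {f g : Path a b} {α β : Cell₂ R.sig f g} (e : Expr₃ R α β) : Rel₃ R e e
  | symm {a b : V} {f g f' g' : Path a b} {α β : Cell₂ R.sig f g} {α' β' : Cell₂ R.sig f' g'}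
      {e : Expr₃ R α β} {e' : Expr₃ R α' β'} : Rel₃ R e e' → Rel₃ R e' e
  | trans {a b : V} {f g f' g' f'' g'' : Path a b} {α β : Cell₂ R.sig f g}
      {α' β' : Cell₂ R.sig f' g'} {α'' β'' : Cell₂ R.sig f'' g''} {e : Expr₃ R α β}
      {e' : Expr₃ R α' β'} {e'' : Expr₃ R α'' β''} :
      Rel₃ R e e' → Rel₃ R e' e'' → Rel₃ R e e''
  | comp_congr {a b : V} {f g f' g' : Path a b} {α β γ : Cell₂ R.sig f g}
      {α' β' γ' : Cell₂ R.sig f' g'} {e : Expr₃ R α β} {d : Expr₃ R β γ}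
      {e' : Expr₃ R α' β'} {d' : Expr₃ R β' γ'} :
      Rel₃ R e e' → Rel₃ R d d' → Rel₃ R (e.comp d) (e'.comp d')
  | vcomp_congr {a b : V} {f g h f' g' h' : Path a b} {α β : Cell₂ R.sig f g}
      {γ δ : Cell₂ R.sig g h} {α' β' : Cell₂ R.sig f' g'} {γ' δ' : Cell₂ R.sig g' h'}
      {e : Expr₃ R α β} {d : Expr₃ R γ δ} {e' : Expr₃ R α' β'} {d' : Expr₃ R γ' δ'} :
      Rel₃ R e e' → Rel₃ R d d' → Rel₃ R (e.vcomp d) (e'.vcomp d')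
  | hcomp_congr {a b c : V} {f g f' g' : Path a b} {h k h' k' : Path b c}
      {α β : Cell₂ R.sig f g} {γ δ : Cell₂ R.sig h k} {α' β' : Cell₂ R.sig f' g'}
      {γ' δ' : Cell₂ R.sig h' k'}
      {e : Expr₃ R α β} {d : Expr₃ R γ δ} {e' : Expr₃ R α' β'} {d' : Expr₃ R γ' δ'} :
      Rel₃ R e e' → Rel₃ R d d' → Rel₃ R (e.hcomp d) (e'.hcomp d')
  | comp_assoc {a b : V} {f g : Path a b} {α β γ δ : Cell₂ R.sig f g} (e₁ : Expr₃ R α β)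
      (e₂ : Expr₃ R β γ) (e₃ : Expr₃ R γ δ) :
      Rel₃ R ((e₁.comp e₂).comp e₃) (e₁.comp (e₂.comp e₃))
  | id_comp {a b : V} {f g : Path a b} {α β : Cell₂ R.sig f g} (e : Expr₃ R α β) :
      Rel₃ R ((Expr₃.id α).comp e) e
  | comp_id {a b : V} {f g : Path a b} {α β : Cell₂ R.sig f g} (e : Expr₃ R α β) :
      Rel₃ R (e.comp (Expr₃.id β)) e
  | vcomp_assoc {a b : V} {f g h k : Path a b} {α₁ β₁ : Cell₂ R.sig f g}
      {α₂ β₂ : Cell₂ R.sig g h} {α₃ β₃ : Cell₂ R.sig h k} (e₁ : Expr₃ R α₁ β₁)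
      (e₂ : Expr₃ R α₂ β₂) (e₃ : Expr₃ R α₃ β₃) :
      Rel₃ R ((e₁.vcomp e₂).vcomp e₃) (e₁.vcomp (e₂.vcomp e₃))
  | id_vcomp {a b : V} {f g : Path a b} {α β : Cell₂ R.sig f g} (e : Expr₃ R α β) :
      Rel₃ R ((Expr₃.id (Cell₂.id f)).vcomp e) e
  | vcomp_id {a b : V} {f g : Path a b} {α β : Cell₂ R.sig f g} (e : Expr₃ R α β) :
      Rel₃ R (e.vcomp (Expr₃.id (Cell₂.id g))) e
  | hcomp_assoc {a b c d : V} {f₁ g₁ : Path a b} {f₂ g₂ : Path b c} {f₃ g₃ : Path c d}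
      {α₁ β₁ : Cell₂ R.sig f₁ g₁} {α₂ β₂ : Cell₂ R.sig f₂ g₂} {α₃ β₃ : Cell₂ R.sig f₃ g₃}
      (e₁ : Expr₃ R α₁ β₁) (e₂ : Expr₃ R α₂ β₂) (e₃ : Expr₃ R α₃ β₃) :
      Rel₃ R ((e₁.hcomp e₂).hcomp e₃) (e₁.hcomp (e₂.hcomp e₃))
  | id_hcomp {a b : V} {f g : Path a b} {α β : Cell₂ R.sig f g} (e : Expr₃ R α β) :
      Rel₃ R ((Expr₃.id (Cell₂.id (Path.nil : Path a a))).hcomp e) e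
  | hcomp_id {a b : V} {f g : Path a b} {α β : Cell₂ R.sig f g} (e : Expr₃ R α β) :
      Rel₃ R (e.hcomp (Expr₃.id (Cell₂.id (Path.nil : Path b b)))) e
  | vcomp_comp {a b : V} {f g h : Path a b} {α β γ : Cell₂ R.sig f g}
      {α' β' γ' : Cell₂ R.sig g h} (e₁ : Expr₃ R α β) (e₂ : Expr₃ R β γ)
      (d₁ : Expr₃ R α' β') (d₂ : Expr₃ R β' γ') :
      Rel₃ R ((e₁.comp e₂).vcomp (d₁.comp d₂)) ((e₁.vcomp d₁).comp (e₂.vcomp d₂))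
  | hcomp_comp {a b c : V} {f g : Path a b} {h k : Path b c} {α β γ : Cell₂ R.sig f g}
      {α' β' γ' : Cell₂ R.sig h k} (e₁ : Expr₃ R α β) (e₂ : Expr₃ R β γ)
      (d₁ : Expr₃ R α' β') (d₂ : Expr₃ R β' γ') :
      Rel₃ R ((e₁.comp e₂).hcomp (d₁.comp d₂)) ((e₁.hcomp d₁).comp (e₂.hcomp d₂))
  | hcomp_vcomp {a b c : V} {f g h : Path a b} {f' g' h' : Path b c}
      {α₁ β₁ : Cell₂ R.sig f g} {α₂ β₂ : Cell₂ R.sig g h}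
      {γ₁ δ₁ : Cell₂ R.sig f' g'} {γ₂ δ₂ : Cell₂ R.sig g' h'}
      (e₁ : Expr₃ R α₁ β₁) (e₂ : Expr₃ R α₂ β₂) (d₁ : Expr₃ R γ₁ δ₁) (d₂ : Expr₃ R γ₂ δ₂) :
      Rel₃ R ((e₁.vcomp e₂).hcomp (d₁.vcomp d₂)) ((e₁.hcomp d₁).vcomp (e₂.hcomp d₂))
  | vcomp_ids {a b : V} {f g h : Path a b} (α : Cell₂ R.sig f g) (β : Cell₂ R.sig g h) :
      Rel₃ R ((Expr₃.id α).vcomp (Expr₃.id β)) (Expr₃.id (α.vcomp β))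
  | hcomp_ids {a b c : V} {f g : Path a b} {h k : Path b c} (α : Cell₂ R.sig f g)
      (β : Cell₂ R.sig h k) :
      Rel₃ R ((Expr₃.id α).hcomp (Expr₃.id β)) (Expr₃.id (α.hcomp β))

def cell₃Setoid (R : ThreePolygraph.{w', w} V) {a b : V} {f g : Path a b}
    (α β : Cell₂ R.sig f g) : Setoid (Expr₃ R α β) where
  r e e' := Rel₃ R e e'
  iseqv := ⟨Rel₃.refl, Rel₃.symm, Rel₃.trans⟩

/-- The 3-cells `α ⇛ β` of the free 3-category on the 3-polygraph `R`. -/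
def Cell₃ (R : ThreePolygraph.{w', w} V) {a b : V} {f g : Path a b} (α β : Cell₂ R.sig f g) :
    Type (max u v w w') :=
  Quotient (cell₃Setoid R α β)

/-! ## Peaks and critical pairs -/

/-- A peak `α₁ ⇚ α ⇛ α₂`: the 2-cell `α` rewrites to `α₁` by the 3-generator `r₁` in the context
`K₁`, and to `α₂` by the 3-generator `r₂` in the context `K₂`. -/
structure Peak (R : ThreePolygraph.{w', w} V) where
  B : Sphere V
  α₁ : Cell₂ R.sig B.src B.tgt
  r₁ : R.Rule
  α : Cell₂ R.sig B.src B.tgt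
  r₂ : R.Rule
  α₂ : Cell₂ R.sig B.src B.tgt
  K₁ : Context R.sig ![R.bd r₁] B
  K₂ : Context R.sig ![R.bd r₂] B
  source₁ : α = K₁.app (R.lhs r₁)
  target₁ : α₁ = K₁.app (R.rhs r₁)
  source₂ : α = K₂.app (R.lhs r₂)
  target₂ : α₂ = K₂.app (R.rhs r₂)

/-- A peak is joinable when there are 3-cells `α₁ ⇛ β` and `α₂ ⇛ β` for some 2-cell `β`. -/
def Peak.Joinable {R : ThreePolygraph.{w', w} V} (p : Peak R) : Prop :=
  ∃ β : Cell₂ R.sig p.B.src p.B.tgt, Nonempty (Cell₃ R p.α₁ β) ∧ Nonempty (Cell₃ R p.α₂ β)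

/-- Local confluence: every peak is joinable. -/
def ThreePolygraph.LocallyConfluent (R : ThreePolygraph.{w', w} V) : Prop :=
  ∀ p : Peak R, p.Joinable

/-- A critical pair: two 3-generators and a most general unifier of their sources. -/
structure CriticalPair (R : ThreePolygraph.{w', w} V) where
  r₁ : R.Rule
  r₂ : R.Rule
  B : Sphere V
  K₁ : Context R.sig ![R.bd r₁] B
  K₂ : Context R.sig ![R.bd r₂] B
  mgu : IsMostGeneralUnifier (R.lhs r₁) (R.lhs r₂) K₁ K₂

/-- The peak induced by a critical pair. -/
noncomputable def CriticalPair.toPeak {R : ThreePolygraph.{w', w} V} (c : CriticalPair R) :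
    Peak R where
  B := c.B
  α₁ := c.K₁.app (R.rhs c.r₁)
  r₁ := c.r₁
  α := c.K₁.app (R.lhs c.r₁)
  r₂ := c.r₂
  α₂ := c.K₂.app (R.rhs c.r₂)
  K₁ := c.K₁
  K₂ := c.K₂
  source₁ := rfl
  target₁ := rfl
  source₂ := c.mgu.unifier
  target₂ := rfl

end Polygraph

/-! A peak is a unifier of the left-hand sides of two rules, so it suffices to join the two
rewriting steps of an arbitrary unifier `K₁, K₂`. There are three cases. If the unifier is trivial,
the two redexes fill the two holes of one binary context, and applying the other rule on each side
gives the same 2-cell. If it is non-trivial and minimal, it is a critical pair. Otherwise it factors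
through another unifier `K₁', K₂'` by a common context `K` that is not invertible. By induction the
smaller steps can be joined, and `K` carries the joining 3-cells along.

The induction needs a measure that strictly decreases when a non-invertible `K` is removed. It is
the pair formed by the number of 2-generators of `K₁` and the length of the source of its boundary,
ordered lexicographically. The first component is additive under composition (`Context.size_comp`)
because variables occur exactly once. If `K` contains no 2-generator, it is a whiskering of its
variable by paths `l` and `r`. Either one of these is non-empty, so `K` lengthens 1-cells, or both
are empty and `K` is an identity (`Context.invertible_of_size_eq_zero`). -/

namespace Polygraph

open Quiver (Path)

/-! ### Formal composites with at most one 2-generator. -/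

section Whiskering

variable {V : Type u} [Quiver.{v} V] {S : Signature.{w} V}

/-- `Rel₂` compares composites of different types. This recovers the equations of paths needed to
bring both sides to a common type, and later to compare lengths. -/
theorem Rel₂.boundary_eq {a b : V} {f g f' g' : Path a b} {e : Expr₂ S f g}
    {e' : Expr₂ S f' g'} (h : Rel₂ S e e') : f = f' ∧ g = g' := by
  induction h with
  | symm _ ih => exact ⟨ih.1.symm, ih.2.symm⟩
  | trans _ _ ih₁ ih₂ => exact ⟨ih₁.1.trans ih₂.1, ih₁.2.trans ih₂.2⟩
  | vcomp_congr _ _ ih₁ ih₂ => exact ⟨ih₁.1, ih₂.2⟩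
  | hcomp_congr _ _ ih₁ ih₂ =>
    exact ⟨congrArg₂ _ ih₁.1 ih₂.1, congrArg₂ _ ih₁.2 ih₂.2⟩
  | _ => simp [Path.comp_assoc, Path.nil_comp]

/-- A formal composite without 2-generators is an identity. -/
theorem Expr₂.rel_id_of_weight_eq_zero {a b : V} {f g : Path a b} (e : Expr₂ S f g)
    (h : e.weight (fun _ => 1) = 0) : Rel₂ S e (Expr₂.id f) := by
  induction e with
  | id f => exact .refl _
  | gen x => exact absurd h one_ne_zero
  | vcomp e d ihe ihd =>
    have h' := Nat.add_eq_zero_iff.mp h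
    have he := ihe h'.1
    -- `e` is an identity, so its source and target coincide; only after this identification does
    -- the unit law apply to the composite with `d`.
    obtain ⟨-, rfl⟩ := he.boundary_eq
    exact (Rel₂.vcomp_congr he (ihd h'.2)).trans (.id_vcomp _)
  | hcomp e d ihe ihd =>
    have h' := Nat.add_eq_zero_iff.mp h
    exact (Rel₂.hcomp_congr (ihe h'.1) (ihd h'.2)).trans (.exchange_id _ _)

/-- A formal composite of exactly one 2-generator is a whiskering of this generator. -/
theorem Expr₂.exists_rel_whisker {a b : V} {f g : Path a b} (e : Expr₂ S f g)
    (h : e.weight (fun _ => 1) = 1) :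
    ∃ (x : S.Gen) (l : Path a (S.bd x).s) (r : Path (S.bd x).t b),
      Rel₂ S e ((Expr₂.id l).hcomp ((Expr₂.gen x).hcomp (Expr₂.id r))) := by
  induction e with
  | id f => exact absurd h zero_ne_one
  | gen x =>
    exact ⟨x, Path.nil, Path.nil, .symm (.trans (.id_hcomp _) (.hcomp_id _))⟩
  | vcomp e d ihe ihd =>
    rcases Nat.add_eq_one_iff.mp h with ⟨h₁, h₂⟩ | ⟨h₁, h₂⟩
    · have he := e.rel_id_of_weight_eq_zero h₁
      obtain ⟨-, rfl⟩ := he.boundary_eq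
      obtain ⟨x, l, r, hd⟩ := ihd h₂
      exact ⟨x, l, r, ((Rel₂.vcomp_congr he (.refl d)).trans (.id_vcomp d)).trans hd⟩
    · obtain ⟨x, l, r, he⟩ := ihe h₁
      exact ⟨x, l, r, ((Rel₂.vcomp_congr (.refl e) (d.rel_id_of_weight_eq_zero h₂)).trans
        (.vcomp_id e)).trans he⟩
  | hcomp e d ihe ihd =>
    rcases Nat.add_eq_one_iff.mp h with ⟨h₁, h₂⟩ | ⟨h₁, h₂⟩
    · obtain ⟨x, l, r, hd⟩ := ihd h₂
      -- The factor without 2-generators is an identity, absorbed into the whiskering path on its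
      -- side.
      exact ⟨x, _, r, ((Rel₂.hcomp_congr (e.rel_id_of_weight_eq_zero h₁) hd).trans
        (.symm (.hcomp_assoc _ _ _))).trans (.hcomp_congr (.exchange_id _ _) (.refl _))⟩
    · obtain ⟨x, l, r, he⟩ := ihe h₁
      exact ⟨x, l, _, ((Rel₂.hcomp_congr he (d.rel_id_of_weight_eq_zero h₂)).trans
        (.hcomp_assoc _ _ _)).trans (.hcomp_congr (.refl _) ((Rel₂.hcomp_assoc _ _ _).trans
          (.hcomp_congr (.refl _) (.exchange_id _ _))))⟩

end Whiskering

/-! ### Calculus of substitutions. -/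

section Substitution

variable {V : Type u} [Quiver.{v} V]

theorem Cell₂.bind_bind {S T U : Signature.{w} V}
    (σ : ∀ x : S.Gen, Cell₂ T (S.bd x).src (S.bd x).tgt)
    (τ : ∀ x : T.Gen, Cell₂ U (T.bd x).src (T.bd x).tgt) {a b : V} {f g : Path a b}
    (α : Cell₂ S f g) :
    (α.bind σ).bind τ = α.bind fun x => (σ x).bind τ := by
  induction α using Quotient.inductionOn with
  | h e =>
    -- `bind` picks representatives of the values of `σ`, so the claim does not hold on the nose for
    -- expressions. The induction keeps every term a 2-cell, where `bind` is functorial.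
    change ((Cell₂.mk e).bind σ).bind τ = (Cell₂.mk e).bind _
    induction e with
    | id => rfl
    | gen x =>
      change ((Cell₂.gen x).bind σ).bind τ = (Cell₂.gen x).bind _
      rw [Cell₂.bind_gen, Cell₂.bind_gen]
    | vcomp e d ihe ihd =>
      change (((Cell₂.mk e).vcomp (Cell₂.mk d)).bind σ).bind τ =
        ((Cell₂.mk e).vcomp (Cell₂.mk d)).bind _
      simp only [Cell₂.bind_vcomp, ihe, ihd]
    | hcomp e d ihe ihd =>
      change (((Cell₂.mk e).hcomp (Cell₂.mk d)).bind σ).bind τ =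
        ((Cell₂.mk e).hcomp (Cell₂.mk d)).bind _
      simp only [Cell₂.bind_hcomp, ihe, ihd]

theorem Cell₂.bind_gen_eq {S : Signature.{w} V} {a b : V} {f g : Path a b} (α : Cell₂ S f g) :
    α.bind Cell₂.gen = α := by
  induction α using Quotient.inductionOn with
  | h e =>
    change (Cell₂.mk e).bind Cell₂.gen = Cell₂.mk e
    induction e with
    | id => rfl
    | gen x => exact Cell₂.bind_gen _ x
    | vcomp e d ihe ihd =>
      change ((Cell₂.mk e).vcomp (Cell₂.mk d)).bind _ = (Cell₂.mk e).vcomp (Cell₂.mk d)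
      rw [Cell₂.bind_vcomp, ihe, ihd]
    | hcomp e d ihe ihd =>
      change ((Cell₂.mk e).hcomp (Cell₂.mk d)).bind _ = (Cell₂.mk e).hcomp (Cell₂.mk d)
      rw [Cell₂.bind_hcomp, ihe, ihd]

theorem Cell₂.bind_incl {S : Signature.{w} V} {n : ℕ} {Γ : Fin n → Sphere V}
    (L : ∀ i, Cell₂ S (Γ i).src (Γ i).tgt) {a b : V} {f g : Path a b} (α : Cell₂ S f g) :
    (α.incl Γ).bind (extAssign Cell₂.gen L) = α := by
  unfold Cell₂.incl
  rw [Cell₂.bind_bind]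
  conv_rhs => rw [← α.bind_gen_eq]
  congr 1
  funext x
  exact Cell₂.bind_gen (S := S.ext Γ) (extAssign Cell₂.gen L) (.old x)

theorem Cell₂.bind_var {S : Signature.{w} V} {n : ℕ} {Γ : Fin n → Sphere V}
    (L : ∀ i, Cell₂ S (Γ i).src (Γ i).tgt) (i : Fin n) :
    (Cell₂.var S Γ i).bind (extAssign Cell₂.gen L) = L i :=
  Cell₂.bind_gen (S := S.ext Γ) (extAssign Cell₂.gen L) (.new i)

/-- Associativity of substitution, in the form that evaluates composites of contexts on 2-cells. -/
theorem Cell₂.bind_subst {S : Signature.{w} V} {n m : ℕ} {Γ : Fin n → Sphere V}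
    {Δ : Fin m → Sphere V} {a b : V} {f g : Path a b} (α : Cell₂ (S.ext Γ) f g)
    (L : ∀ i, Cell₂ (S.ext Δ) (Γ i).src (Γ i).tgt) (M : ∀ i, Cell₂ S (Δ i).src (Δ i).tgt) :
    (α.subst L).bind (extAssign Cell₂.gen M) =
      α.bind (extAssign Cell₂.gen fun i => (L i).bind (extAssign Cell₂.gen M)) := by
  unfold Cell₂.subst
  rw [Cell₂.bind_bind]
  congr 1
  funext y
  cases y with
  | old x => exact Cell₂.bind_gen (S := S.ext Δ) (extAssign Cell₂.gen M) (.old x)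
  | new i => rfl

end Substitution

/-- The weight function with value `c` on the 2-generators of `S` and `d` on the variables. -/
def ExtGen.const {V : Type u} [Quiver.{v} V] {S : Signature.{w} V} {n : ℕ} (c d : ℕ) :
    ExtGen S n → ℕ
  | .old _ => c
  | .new _ => d

/-! ### Evaluation, size and invertibility of contexts. -/

namespace Context

variable {V : Type u} [Quiver.{v} V] {S : Signature.{w} V} {A A₁ A₂ B C : Sphere V}

theorem app_comp (K : Context S ![B] C) (L : Context S ![A] B) (α : Cell₂ S A.src A.tgt) :
    (K.comp L).app α = K.app (L.app α) := by
  refine (Cell₂.bind_subst K.cell (single L.cell) (single α)).trans ?_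
  unfold app
  congr 2
  funext i
  obtain rfl := Subsingleton.elim i 0
  rfl

/-- Together with `app_fillLeft`, this expresses both sides of a trivial unifier by simultaneous
substitution in the same binary context. -/
theorem app_fillRight (K : Context S ![A₁, A₂] B) (α₁ : Cell₂ S A₁.src A₁.tgt)
    (α₂ : Cell₂ S A₂.src A₂.tgt) :
    (K.fillRight α₂).app α₁ = K.cell.bind (extAssign Cell₂.gen (pair α₁ α₂)) := by
  refine (Cell₂.bind_subst K.cell _ (single α₁)).trans ?_
  congr 2
  funext i
  match i with
  | 0 => exact Cell₂.bind_var (Γ := ![A₁]) (single α₁) 0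
  | 1 => exact Cell₂.bind_incl (Γ := ![A₁]) (single α₁) α₂

theorem app_fillLeft (K : Context S ![A₁, A₂] B) (α₁ : Cell₂ S A₁.src A₁.tgt)
    (α₂ : Cell₂ S A₂.src A₂.tgt) :
    (K.fillLeft α₁).app α₂ = K.cell.bind (extAssign Cell₂.gen (pair α₁ α₂)) := by
  refine (Cell₂.bind_subst K.cell _ (single α₂)).trans ?_
  congr 2
  funext i
  match i with
  | 0 => exact Cell₂.bind_incl (Γ := ![A₂]) (single α₂) α₁
  | 1 => exact Cell₂.bind_var (Γ := ![A₂]) (single α₂) 0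

theorem id_comp (L : Context S ![A] B) : (id S B).comp L = L := by
  ext
  exact Cell₂.bind_gen (S := S.ext ![B]) (extAssign (Cell₂.oldGen ![A]) (single L.cell)) (.new 0)

theorem invertible_id : (id S A).Invertible :=
  ⟨id S A, id_comp _, id_comp _⟩

/-- The number of occurrences of 2-generators of `S` in a context. -/
def size {n : ℕ} {Γ : Fin n → Sphere V} (K : Context S Γ B) : ℕ :=
  K.cell.weight (ExtGen.const 1 0)

/-- The variable of `K` occurs exactly once, so the 2-generators of `L` are counted exactly once. -/
theorem size_comp (K : Context S ![B] C) (L : Context S ![A] B) :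
    (K.comp L).size = K.size + L.size := by
  have h₁ := Cell₂.weight_bind (extAssign (Cell₂.oldGen ![A]) (single L.cell))
    (ExtGen.const 1 0) K.cell
  refine h₁.trans ?_
  -- After substitution the variable weighs `L.size` and each 2-generator 1. This weight is split
  -- into a sum, whose variable part is `L.size` times one occurrence.
  have h₂ := Cell₂.weight_new K.cell (ExtGen.const 0 L.size) fun _ => rfl
  rw [Fin.sum_univ_one, K.linear, mul_one] at h₂
  refine Eq.trans ?_ (congrArg (K.size + ·) h₂)
  refine Eq.trans ?_ (Cell₂.weight_add _ _ _)
  congr 1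
  funext y
  cases y with
  | old x => rfl
  | new i =>
    obtain rfl := Subsingleton.elim i 0
    exact (Nat.zero_add _).symm

/-- A unary context without 2-generators is a whiskering of its variable. -/
theorem exists_whisker_of_size_eq_zero (K : Context S ![A] B) (h : K.size = 0) :
    ∃ (l : Path B.s A.s) (r : Path A.t B.t) (e : Expr₂ (S.ext ![A]) B.src B.tgt),
      Cell₂.mk e = K.cell ∧ Rel₂ (S.ext ![A]) e
        ((Expr₂.id l).hcomp ((Expr₂.gen (S := S.ext ![A]) (.new 0)).hcomp (Expr₂.id r))) := by
  -- The conclusion keeps a representative because the whiskering has the boundary of `K` only up to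
  -- a propositional equality: `Rel₂` can compare them, equality in `Cell₂` cannot.
  obtain ⟨e, he⟩ := Quotient.exists_rep K.cell
  have hnew := Cell₂.weight_new K.cell (ExtGen.const 0 1) fun _ => rfl
  rw [Fin.sum_univ_one, K.linear, mul_one] at hnew
  -- In total: no 2-generator of `S`, plus one occurrence of the variable.
  have hone : K.cell.weight (fun _ => 1) = 1 := by
    refine Eq.trans ?_ (congrArg₂ (· + ·) h hnew)
    unfold size
    refine Eq.trans ?_ (Cell₂.weight_add _ _ _)
    congr 1
    funext y
    cases y <;> rfl
  unfold size at h
  rw [← he] at hone h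
  obtain ⟨x, l, r, hx⟩ := e.exists_rel_whisker hone
  have hw := Rel₂.weight_eq (ExtGen.const 1 0) hx
  cases x with
  | old x => exact absurd (h.symm.trans hw) (by simp [Expr₂.weight, ExtGen.const])
  | new i =>
    obtain rfl := Subsingleton.elim i 0
    exact ⟨l, r, e, he, hx⟩

/-- A unary context without 2-generators which does not lengthen 1-cells is invertible. -/
theorem invertible_of_size_eq_zero (K : Context S ![A] B) (h : K.size = 0)
    (hl : B.src.length ≤ A.src.length) : K.Invertible := by
  obtain ⟨l, r, e, he, hrel⟩ := K.exists_whisker_of_size_eq_zero h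
  obtain ⟨f, g⟩ := A
  obtain ⟨f', g'⟩ := B
  dsimp only at l r e he hrel hl
  have hb : f' = l.comp (f.comp r) ∧ g' = l.comp (g.comp r) := hrel.boundary_eq
  -- The source of `B` has the length of `l`, plus that of the source of `A`, plus that of `r`; by
  -- `hl` both whiskering paths are empty.
  have hlen := congrArg Path.length hb.1
  rw [Path.length_comp, Path.length_comp] at hlen
  have hl₀ : l.length = 0 := by omega
  have hr₀ : r.length = 0 := by omega
  -- The endpoints must be identified before `l` and `r` can be equated with empty paths.
  obtain rfl := Path.eq_of_length_zero l hl₀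
  obtain rfl := Path.eq_of_length_zero r hr₀
  obtain rfl := Path.eq_nil_of_length_zero l hl₀
  obtain rfl := Path.eq_nil_of_length_zero r hr₀
  obtain ⟨h₁, h₂⟩ := hb
  rw [Path.nil_comp] at h₁ h₂
  obtain rfl : f' = f := h₁
  obtain rfl : g' = g := h₂
  have hK : K = id S _ := by
    ext
    rw [← he]
    exact Quotient.sound (hrel.trans (.trans (.id_hcomp _) (.hcomp_id _)))
  rw [hK]
  exact invertible_id

end Context

/-! ### 3-cells in contexts and joinability of unifiers. -/

section Rewriting

variable {V : Type u} [Quiver.{v} V] {R : ThreePolygraph.{w', w} V}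

/-- 3-cells may be substituted for the 2-generators of a 2-cell. -/
theorem Cell₃.nonempty_bind {S : Signature.{w} V}
    {σ τ : ∀ x : S.Gen, Cell₂ R.sig (S.bd x).src (S.bd x).tgt}
    (h : ∀ x, Nonempty (Cell₃ R (σ x) (τ x))) {a b : V} {f g : Path a b} (α : Cell₂ S f g) :
    Nonempty (Cell₃ R (α.bind σ) (α.bind τ)) := by
  -- Only the existence of 3-cells matters, so formal composites suffice and the relations `Rel₃`
  -- play no role.
  suffices H : Nonempty (Expr₃ R (α.bind σ) (α.bind τ)) from H.map (Quotient.mk _)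
  induction α using Quotient.inductionOn with
  | h e =>
    change Nonempty (Expr₃ R ((Cell₂.mk e).bind σ) ((Cell₂.mk e).bind τ))
    induction e with
    | id f => exact ⟨.id (Cell₂.id f)⟩
    | gen x =>
      change Nonempty (Expr₃ R ((Cell₂.gen x).bind σ) ((Cell₂.gen x).bind τ))
      rw [Cell₂.bind_gen, Cell₂.bind_gen]
      exact (h x).map Quotient.out
    | vcomp e d ihe ihd =>
      change Nonempty (Expr₃ R (((Cell₂.mk e).vcomp (Cell₂.mk d)).bind σ)
        (((Cell₂.mk e).vcomp (Cell₂.mk d)).bind τ))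
      rw [Cell₂.bind_vcomp, Cell₂.bind_vcomp]
      exact ⟨.vcomp ihe.some ihd.some⟩
    | hcomp e d ihe ihd =>
      change Nonempty (Expr₃ R (((Cell₂.mk e).hcomp (Cell₂.mk d)).bind σ)
        (((Cell₂.mk e).hcomp (Cell₂.mk d)).bind τ))
      rw [Cell₂.bind_hcomp, Cell₂.bind_hcomp]
      exact ⟨.hcomp ihe.some ihd.some⟩

theorem Cell₃.nonempty_refl {a b : V} {f g : Path a b} (α : Cell₂ R.sig f g) :
    Nonempty (Cell₃ R α α) :=
  ⟨Quotient.mk _ (.id α)⟩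

theorem Cell₃.nonempty_rule (r : R.Rule) : Nonempty (Cell₃ R (R.lhs r) (R.rhs r)) :=
  ⟨Quotient.mk _ (.gen r)⟩

/-- Identity 3-cells are used at the 2-generators, so only the variables are rewritten. One variable
gives rewriting in a context; two give the joining of disjoint steps. -/
theorem Cell₃.nonempty_bind_ext {n : ℕ} {Γ : Fin n → Sphere V}
    {L M : ∀ i, Cell₂ R.sig (Γ i).src (Γ i).tgt} (h : ∀ i, Nonempty (Cell₃ R (L i) (M i)))
    {a b : V} {f g : Path a b} (α : Cell₂ (R.sig.ext Γ) f g) :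
    Nonempty (Cell₃ R (α.bind (extAssign Cell₂.gen L)) (α.bind (extAssign Cell₂.gen M))) :=
  Cell₃.nonempty_bind (S := R.sig.ext Γ) (fun y => match y with
    | ExtGen.old x => Cell₃.nonempty_refl (Cell₂.gen x)
    | ExtGen.new i => h i) α

theorem Cell₃.nonempty_app {A B : Sphere V} (K : Context R.sig ![A] B)
    {α β : Cell₂ R.sig A.src A.tgt} (h : Nonempty (Cell₃ R α β)) :
    Nonempty (Cell₃ R (K.app α) (K.app β)) :=
  Cell₃.nonempty_bind_ext (Γ := ![A]) (L := single α) (M := single β) (fun | 0 => h) K.cell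

/-- Two rewriting steps at disjoint positions can be joined. -/
theorem IsTrivial.joinable {r₁ r₂ : R.Rule} {B : Sphere V} {K₁ : Context R.sig ![R.bd r₁] B}
    {K₂ : Context R.sig ![R.bd r₂] B} (h : IsTrivial (R.lhs r₁) (R.lhs r₂) K₁ K₂) :
    ∃ β, Nonempty (Cell₃ R (K₁.app (R.rhs r₁)) β) ∧ Nonempty (Cell₃ R (K₂.app (R.rhs r₂)) β) := by
  obtain ⟨K, rfl, rfl⟩ := h
  -- The common reduct has both redexes contracted.
  refine ⟨K.cell.bind (extAssign Cell₂.gen (pair (R.rhs r₁) (R.rhs r₂))), ?_, ?_⟩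
  · rw [Context.app_fillRight]
    exact Cell₃.nonempty_bind_ext (Γ := ![R.bd r₁, R.bd r₂])
      (L := pair (R.rhs r₁) (R.lhs r₂)) (M := pair (R.rhs r₁) (R.rhs r₂))
      (fun | 0 => Cell₃.nonempty_refl _ | 1 => Cell₃.nonempty_rule r₂) K.cell
  · rw [Context.app_fillLeft]
    exact Cell₃.nonempty_bind_ext (Γ := ![R.bd r₁, R.bd r₂])
      (L := pair (R.lhs r₁) (R.rhs r₂)) (M := pair (R.rhs r₁) (R.rhs r₂))
      (fun | 0 => Cell₃.nonempty_rule r₁ | 1 => Cell₃.nonempty_refl _) K.cell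

/-- If all critical pairs are joinable, then so are the two rewriting steps of every unifier of
the sources of two rules. A unifier which is not minimal factors through one which is smaller for
the lexicographic order on the number of 2-generators and the length of the source. -/
theorem IsUnifier.joinable (h : ∀ c : CriticalPair R, c.toPeak.Joinable) {r₁ r₂ : R.Rule}
    {B : Sphere V} (K₁ : Context R.sig ![R.bd r₁] B) (K₂ : Context R.sig ![R.bd r₂] B)
    (hK : IsUnifier (R.lhs r₁) (R.lhs r₂) K₁ K₂) :
    ∃ β, Nonempty (Cell₃ R (K₁.app (R.rhs r₁)) β) ∧ Nonempty (Cell₃ R (K₂.app (R.rhs r₂)) β) := by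
  by_cases ht : IsTrivial (R.lhs r₁) (R.lhs r₂) K₁ K₂
  · exact ht.joinable
  by_cases hm : IsMinimal (R.lhs r₁) (R.lhs r₂) K₁ K₂
  · exact h ⟨r₁, r₂, B, K₁, K₂, hK, ht, hm⟩
  unfold IsMinimal at hm
  push Not at hm
  obtain ⟨B', K₁', K₂', K, hK', h₁, h₂, hinv⟩ := hm
  have hsize : K₁.size = K.size + K₁'.size := h₁ ▸ K.size_comp K₁'
  -- Without a decrease, `hsize` forces `K.size = 0` and the source of `B` is no longer than that of
  -- `B'`, so `K` would be invertible. As `K` is common to both factorizations, measuring `K₁` alone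
  -- is enough.
  have hlt : K₁'.size < K₁.size ∨ K₁'.size = K₁.size ∧ B'.src.length < B.src.length := by
    by_contra hcon
    refine hinv (K.invertible_of_size_eq_zero ?_ ?_) <;> omega
  obtain ⟨β, hβ₁, hβ₂⟩ := IsUnifier.joinable h K₁' K₂' hK'
  refine ⟨K.app β, ?_, ?_⟩
  · rw [h₁, Context.app_comp]
    exact Cell₃.nonempty_app K hβ₁
  · rw [h₂, Context.app_comp]
    exact Cell₃.nonempty_app K hβ₂
termination_by (K₁.size, B.src.length)
decreasing_by
  rw [Prod.lex_def]
  exact hlt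

end Rewriting

end Polygraph

theorem mainTheorem4 {V : Type u} [Quiver.{v} V] (R : Polygraph.ThreePolygraph.{w', w} V)
    (h : ∀ c : Polygraph.CriticalPair R, c.toPeak.Joinable) : R.LocallyConfluent := by
  -- Eliminating the other equations of the peak turns `source₂` into the unifier condition.
  rintro ⟨B, _, r₁, _, r₂, _, K₁, K₂, rfl, rfl, hK, rfl⟩
  exact Polygraph.IsUnifier.joinable h K₁ K₂ hK
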